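/- Let $d\ge 0$, $m\ge 1$, $0\le k\le m$ be integers, let $X=\mathbb{R}^d$ and let $X^*$ be its dual space. Let $f_1,\dots,f_m:X\to\,]-\infty,+\infty]$. Suppose that for $1\le i\le k$ the function $f_i$ is polyhedrally convex, i.e. its epigraph $\operatorname{epi} f_i=\{(x,r)\in X\times\mathbb{R} : f_i(x)\le r\}$ is a finite intersection of closed halfspaces, and that for $k<i\le m$ the function $f_i$ is proper (not identically $+\infty$) and convex. Assume that there is a point $x_0\in\bigcap_{i=1}^m\operatorname{dom} f_i$, where $\operatorname{dom} f_i=\{x: f_i(x)<+\infty\}$, such that $f_i$ is continuous at $x_0$ for every $k<i\le m$. For $f:X\to\,]-\infty,+\infty]$ let $f^*(x^*)=\sup_{x\in X}\{\langle x,x^*\rangle-f(x)\}$ for $x^*\in X^*$, and let $\partial f(x)=\{x^*\in X^* : \langle y-x,x^*\rangle+f(x)\le f(y)\ \text{for all } y\in X\}$ if $f(x)\in\mathbb{R}$ and $\partial f(x)=\varnothing$ otherwise. Let $$(f_1^*\Box\cdots\Box f_m^*)(x^*)=\inf\Big\{\sum_{i=1}^m f_i^*(x_i^*) : x_1^*,\dots,x_m^*\in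 X^*,\ \sum_{i=1}^m x_i^*=x^*\Big\}.$$ Then for every $x^*\in X^*$ $$\Big(\sum_{i=1}^m f_i\Big)^*(x^*)=(f_1^*\Box\cdots\Box f_m^*)(x^*),$$ and the infimum defining the right-hand side is attained (the infimal convolution is exact everywhere). Furthermore, for every $x\in X$, $$\partial(f_1+\cdots+f_m)(x)=\partial f_1(x)+\cdots+\partial f_m(x),$$ where the right-hand side is the Minkowski sum of sets. -/

import Mathlib

open scoped Pointwise

namespace ConvexDuality

/-- The effective domain of an extended-real-valued function. -/
def dom {X : Type*} (f : X → EReal) : Set X := {x | f x < ⊤}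

/-- The epigraph of an extended-real-valued function, as a subset of `X × ℝ`. -/
def epi {X : Type*} (f : X → EReal) : Set (X × ℝ) := {p | f p.1 ≤ (p.2 : EReal)}

/-- A function is proper if its domain is nonempty and it never takes the value `-∞`. -/
def IsProper {X : Type*} (f : X → EReal) : Prop := (dom f).Nonempty ∧ ∀ x, f x ≠ ⊥

/-- Convexity of an extended-real-valued function: its epigraph is a convex set. -/
def IsConvex {X : Type*} [AddCommGroup X] [Module ℝ X] (f : X → EReal) : Prop :=
  Convex ℝ (epi f)

/-- A polyhedral set: a finite intersection of closed halfspaces `{x | a x ≤ b}`, `a ≠ 0`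
(the empty intersection being the whole space). -/
def IsPolyhedral {E : Type*} [NormedAddCommGroup E] [NormedSpace ℝ E] (S : Set E) : Prop :=
  ∃ (n : ℕ) (a : Fin n → (E →L[ℝ] ℝ)) (b : Fin n → ℝ),
    (∀ i, a i ≠ 0) ∧ S = ⋂ i, {x | a i x ≤ b i}

/-- A function is polyhedrally convex if its epigraph is a polyhedral set. -/
def IsPolyhedrallyConvex {X : Type*} [NormedAddCommGroup X] [NormedSpace ℝ X]
    (f : X → EReal) : Prop :=
  IsPolyhedral (epi f)

/-- The Fenchel conjugate `f*(x*) = sup_x (⟨x, x*⟩ - f x)` on the continuous dual. -/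
noncomputable def conjugate {X : Type*} [NormedAddCommGroup X] [NormedSpace ℝ X]
    (f : X → EReal) (xs : X →L[ℝ] ℝ) : EReal :=
  ⨆ x : X, ((xs x : ℝ) : EReal) - f x

/-- The infimal convolution `(ψ₁ □ ⋯ □ ψₘ)(z)`, the infimum of `ψ₁(z₁) + ⋯ + ψₘ(zₘ)` over all
`z₁ + ⋯ + zₘ = z`. -/
noncomputable def infConv {Z : Type*} [AddCommGroup Z] {m : ℕ}
    (ψ : Fin m → Z → EReal) (z : Z) : EReal :=
  ⨅ (w : Fin m → Z) (_ : ∑ i, w i = z), ∑ i, ψ i (w i)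

/-- The infimal convolution is exact at `z` if the infimum defining it is attained. -/
def InfConvExactAt {Z : Type*} [AddCommGroup Z] {m : ℕ}
    (ψ : Fin m → Z → EReal) (z : Z) : Prop :=
  ∃ w : Fin m → Z, ∑ i, w i = z ∧ ∑ i, ψ i (w i) = infConv ψ z

/-- The subdifferential of `f` at `x`; it is empty where `f x` is not a real number. -/
def subdifferential {X : Type*} [NormedAddCommGroup X] [NormedSpace ℝ X]
    (f : X → EReal) (x : X) : Set (X →L[ℝ] ℝ) :=
  {xs | f x ≠ ⊥ ∧ f x ≠ ⊤ ∧ ∀ y, ((xs (y - x) : ℝ) : EReal) + f x ≤ f y}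

end ConvexDuality

/-! A bound `f*(w) ≤ β` says that `w - β` is an affine minorant of `f`, i.e. `w x - r ≤ β` on the
epigraph. Both claims thus reduce to splitting an affine minorant of the sum into affine minorants
of the summands, with constants adding up to at most `α` (`exists_split`). Taking `α` to be the
conjugate of the sum gives exactness; taking `α` tight at `x` gives the subdifferential formula. The
converse inclusion and inequality hold termwise. The polyhedral summands are split all at once by
Farkas' lemma, which needs only a common point of the domains. The others are then peeled off one at
a time by Hahn-Banach: continuity at `x₀` gives the epigraph interior above `x₀`, so the separating
hyperplane is not vertical. -/

namespace ConvexDuality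

/-! ### Linear and affine Farkas lemmas -/

section Farkas

variable {V : Type*} [AddCommGroup V] [Module ℝ V]

/-- Farkas' lemma for finitely many linear functionals. -/
theorem farkas {ι : Type*} (s : Finset ι) (a : ι → V →ₗ[ℝ] ℝ) (b : V →ₗ[ℝ] ℝ)
    (h : ∀ x, (∀ i ∈ s, a i x ≤ 0) → b x ≤ 0) :
    ∃ l : ι → ℝ, (∀ i ∈ s, 0 ≤ l i) ∧ ∑ i ∈ s, l i • a i = b := by
  classical
  induction s using Finset.induction_on generalizing a b with
  | empty =>
    refine ⟨0, by simp, ?_⟩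
    ext x
    have h1 := h x (by simp)
    have h2 := h (-x) (by simp)
    simp only [map_neg] at h2
    simp only [Finset.sum_empty, LinearMap.zero_apply]
    linarith
  | insert n s hn ih =>
    by_cases hb : ∀ x, (∀ i ∈ s, a i x ≤ 0) → b x ≤ 0
    · obtain ⟨l, hl, hs⟩ := ih a b hb
      have key : ∀ i ∈ s, (if i = n then 0 else l i) = l i := fun i hi =>
        if_neg (by rintro rfl; exact hn hi)
      refine ⟨fun i => if i = n then 0 else l i, ?_, ?_⟩
      · intro i hi
        by_cases hin : i = n
        · simp [hin]
        · simpa [hin] using hl i ((Finset.mem_insert.1 hi).resolve_left hin)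
      · simp only [Finset.sum_insert hn, ← hs, if_true, zero_smul, zero_add]
        exact Finset.sum_congr rfl fun i hi => by rw [key i hi]
    · push Not at hb
      obtain ⟨y, hy, hby⟩ := hb
      have hny : 0 < a n y := by
        by_contra hc
        refine absurd (h y fun i hi => ?_) (not_le.2 hby)
        rcases Finset.mem_insert.1 hi with rfl | hi
        · exact not_lt.1 hc
        · exact hy i hi
      -- Compose every functional with the projection along `y` onto the kernel of `a n`, where
      -- constraint `n` holds trivially.
      obtain ⟨l, hl, hs⟩ := ih (fun i => a i - (a i y / a n y) • a n)
        (b - (b y / a n y) • a n) (by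
          intro x hx
          have := h (x - (a n x / a n y) • y) (by
            intro i hi
            rcases Finset.mem_insert.1 hi with rfl | hi
            · simp only [map_sub, map_smul, smul_eq_mul]
              rw [div_mul_cancel₀ _ hny.ne', sub_self]
            · have := hx i hi
              simp only [LinearMap.sub_apply, LinearMap.smul_apply, smul_eq_mul] at this
              simp only [map_sub, map_smul, smul_eq_mul]
              convert this using 2
              ring)
          simp only [map_sub, map_smul, smul_eq_mul] at this
          simp only [LinearMap.sub_apply, LinearMap.smul_apply, smul_eq_mul]
          convert this using 2
          ring)
      -- Undoing the projection leaves this coefficient on `a n`; it is nonnegative since `a i y ≤ 0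
      -- < b y`.
      set c : ℝ := b y / a n y - ∑ i ∈ s, l i * (a i y / a n y) with hc
      have key : ∀ i ∈ s, (if i = n then c else l i) = l i := fun i hi =>
        if_neg (by rintro rfl; exact hn hi)
      refine ⟨fun i => if i = n then c else l i, ?_, ?_⟩
      · intro i hi
        by_cases hin : i = n
        · simp only [hin, if_true, hc]
          have h1 : 0 ≤ b y / a n y := by positivity
          have h2 : ∑ i ∈ s, l i * (a i y / a n y) ≤ 0 := Finset.sum_nonpos fun i hi =>
            mul_nonpos_of_nonneg_of_nonpos (hl i hi)
              (div_nonpos_of_nonpos_of_nonneg (hy i hi) hny.le)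
          linarith
        · simpa [hin] using hl i ((Finset.mem_insert.1 hi).resolve_left hin)
      · rw [Finset.sum_insert hn, Finset.sum_congr rfl fun i hi => congrArg (· • a i) (key i hi)]
        simp only [if_true]
        ext x
        have := LinearMap.congr_fun hs x
        simp only [LinearMap.sum_apply, LinearMap.sub_apply, LinearMap.smul_apply,
          smul_eq_mul, mul_sub, Finset.sum_sub_distrib] at this
        simp only [LinearMap.add_apply, LinearMap.sum_apply, LinearMap.smul_apply,
          smul_eq_mul, hc, sub_mul, Finset.sum_mul]
        simp only [mul_assoc] at this ⊢
        linarith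

/-- The affine form of Farkas' lemma: an affine inequality implied by a feasible finite system of
affine inequalities is a nonnegative combination of them. -/
theorem affine_farkas {ι : Type*} [Fintype ι] (a : ι → V →ₗ[ℝ] ℝ) (b : ι → ℝ)
    (c : V →ₗ[ℝ] ℝ) (α : ℝ) (hfeas : ∃ x₀, ∀ i, a i x₀ ≤ b i)
    (h : ∀ x, (∀ i, a i x ≤ b i) → c x ≤ α) :
    ∃ l : ι → ℝ, (∀ i, 0 ≤ l i) ∧ ∑ i, l i • a i = c ∧ ∑ i, l i * b i ≤ α := by
  classical
  obtain ⟨x₀, hx₀⟩ := hfeas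
  -- Homogenize with a variable `t`; the index `none` carries the constraint `t ≥ 0`.
  obtain ⟨l, hl, hs⟩ := farkas (V := V × ℝ) (Finset.univ : Finset (Option ι))
    (fun o => o.elim (-LinearMap.snd ℝ V ℝ)
      fun i => a i ∘ₗ LinearMap.fst ℝ V ℝ - b i • LinearMap.snd ℝ V ℝ)
    (c ∘ₗ LinearMap.fst ℝ V ℝ - α • LinearMap.snd ℝ V ℝ) (by
      rintro ⟨x, t⟩ hx
      have ht : 0 ≤ t := by simpa using hx none (Finset.mem_univ _)
      have hx' : ∀ i, a i x ≤ b i * t := fun i => by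
        simpa using hx (some i) (Finset.mem_univ _)
      suffices c x ≤ α * t by simpa using this
      rcases ht.eq_or_lt with rfl | ht
      · simp only [mul_zero] at hx' ⊢
        by_contra! hc
        -- At `t = 0`, `x` is a recession direction: this step from `x₀` stays feasible but pushes
        -- `c` above `α`.
        have := h (x₀ + ((|α - c x₀| + 1) / c x) • x) (by
          intro i
          have h1 : 0 ≤ (|α - c x₀| + 1) / c x := by positivity
          simp only [map_add, map_smul, smul_eq_mul]
          have := mul_nonpos_of_nonneg_of_nonpos h1 (hx' i)
          linarith [hx₀ i])
        simp only [map_add, map_smul, smul_eq_mul] at this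
        rw [div_mul_cancel₀ _ hc.ne'] at this
        linarith [le_abs_self (α - c x₀)]
      · have := h (t⁻¹ • x) (by
          intro i
          rw [map_smul, smul_eq_mul, inv_mul_le_iff₀ ht, mul_comm]
          exact hx' i)
        rw [map_smul, smul_eq_mul, inv_mul_le_iff₀ ht, mul_comm] at this
        exact this)
  refine ⟨fun i => l (some i), fun i => hl _ (Finset.mem_univ _), ?_, ?_⟩
  · ext x
    simpa [Fintype.sum_option] using LinearMap.congr_fun hs (x, 0)
  · have := LinearMap.congr_fun hs (0, 1)
    simp [Fintype.sum_option] at this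
    linarith [hl none (Finset.mem_univ _)]

end Farkas

/-! ### Splitting affine minorants of a sum -/

section Epigraphs

variable {E : Type*} [NormedAddCommGroup E] [NormedSpace ℝ E]

/-- An affine functional minorizing the sum of polyhedral epigraphs splits into affine
functionals minorizing the summands. -/
theorem exists_split_polyhedral {ι : Type*} [Fintype ι] (C : ι → Set (E × ℝ))
    (hC : ∀ i, IsPolyhedral (C i)) (hne : ∃ (x : E) (r : ι → ℝ), ∀ i, (x, r i) ∈ C i)
    (a : E →L[ℝ] ℝ) (α : ℝ)
    (h : ∀ (x : E) (r : ι → ℝ), (∀ i, (x, r i) ∈ C i) → a x - ∑ i, r i ≤ α) :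
    ∃ (w : ι → E →L[ℝ] ℝ) (β : ι → ℝ), (∀ i, ∀ p ∈ C i, w i p.1 - p.2 ≤ β i) ∧
      ∑ i, w i = a ∧ ∑ i, β i ≤ α := by
  classical
  choose n A b _ hCA using hC
  have hmem : ∀ i p, p ∈ C i ↔ ∀ j, A i j p ≤ b i j := fun i p => by
    rw [hCA i]; simp
  let ev : ι → E × (ι → ℝ) →ₗ[ℝ] E × ℝ := fun i =>
    (LinearMap.fst ℝ E (ι → ℝ)).prod (LinearMap.proj i ∘ₗ LinearMap.snd ℝ E (ι → ℝ))
  have hev : ∀ i x r, ev i (x, r) = (x, r i) := fun i x r => rfl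
  obtain ⟨l, hl, hs, hb⟩ := affine_farkas (V := E × (ι → ℝ)) (ι := Σ i, Fin (n i))
    (fun q => (A q.1 q.2 : E × ℝ →ₗ[ℝ] ℝ) ∘ₗ ev q.1) (fun q => b q.1 q.2)
    ((a : E →ₗ[ℝ] ℝ) ∘ₗ LinearMap.fst ℝ E (ι → ℝ)
      - ∑ i, LinearMap.proj i ∘ₗ LinearMap.snd ℝ E (ι → ℝ)) α
    (by
      obtain ⟨x, r, hx⟩ := hne
      exact ⟨(x, r), fun q => (hmem _ _).1 (hx q.1) q.2⟩)
    (by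
      rintro ⟨x, r⟩ hx
      have := h x r fun i => (hmem _ _).2 fun j => hx ⟨i, j⟩
      simpa [sum_apply] using this)
  rw [Fintype.sum_sigma] at hb hs
  have happ : ∀ (x : E) (r : ι → ℝ), ∑ i, ∑ j, l ⟨i, j⟩ * A i j (x, r i) = a x - ∑ i, r i := fun x r => by
    have := LinearMap.congr_fun hs (x, r)
    simpa [sum_apply, hev] using this
  -- Each summand has its own height variable, so comparing coefficients normalizes every block
  -- separately.
  have hone : ∀ i, ∑ j, l ⟨i, j⟩ * A i j (0, 1) = -1 := fun i => by
    have := happ 0 (Pi.single i 1)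
    rw [Finset.sum_eq_single i] at this
    · simpa using this
    · intro i' _ hi'
      simp only [Pi.single_eq_of_ne hi', Prod.mk_zero_zero, map_zero, mul_zero,
        Finset.sum_const_zero]
    · simp
  refine ⟨fun i => ∑ j, l ⟨i, j⟩ • (A i j).comp (ContinuousLinearMap.inl ℝ E ℝ),
    fun i => ∑ j, l ⟨i, j⟩ * b i j, ?_, ?_, hb⟩
  · rintro i ⟨x, r⟩ hp
    have h1 : ∑ j, l ⟨i, j⟩ * A i j (x, r) ≤ ∑ j, l ⟨i, j⟩ * b i j :=
      Finset.sum_le_sum fun j _ => mul_le_mul_of_nonneg_left ((hmem _ _).1 hp j) (hl _)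
    have h2 : ∀ j, A i j (x, r) = A i j (x, 0) + r * A i j (0, 1) := fun j => by
      rw [← smul_eq_mul, ← map_smul, ← map_add]; simp
    have h3 : ∑ j, l ⟨i, j⟩ * A i j (x, r) = ∑ j, l ⟨i, j⟩ * A i j (x, 0) - r := by
      have : ∑ j, l ⟨i, j⟩ * (r * A i j (0, 1)) = r * -1 := by
        rw [← hone i, Finset.mul_sum]
        exact Finset.sum_congr rfl fun j _ => by ring
      simp only [h2, mul_add, Finset.sum_add_distrib, this]
      ring
    simpa [sum_apply, ← h3] using h1
  · ext x
    simpa [sum_apply] using happ x 0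

/-- Splitting an affine minorant of a sum of two convex functions, given by sets of points above
their graphs, one of which is bounded above near a common point. -/
theorem exists_split_of_interior {C D : Set (E × ℝ)} (hC : Convex ℝ C) (hD : Convex ℝ D)
    {x₀ : E} (hx₀C : ∃ r, (x₀, r) ∈ interior C) (hx₀D : ∃ s, (x₀, s) ∈ D) (a : E →L[ℝ] ℝ) (α : ℝ)
    (h : ∀ x r s, (x, r) ∈ C → (x, s) ∈ D → a x - (r + s) ≤ α) :
    ∃ (w : E →L[ℝ] ℝ) (β : ℝ), (∀ p ∈ C, w p.1 - p.2 ≤ β) ∧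
      ∀ p ∈ D, (a - w) p.1 - p.2 ≤ α - β := by
  -- At an interior point the height can still be lowered, which makes the bound strict.
  have hlt : ∀ x r s, (x, r) ∈ interior C → (x, s) ∈ D → a x - (r + s) < α := by
    intro x r s hr hs
    have hcont : Continuous fun t : ℝ => (x, t) := by fun_prop
    have hnhds : ∀ᶠ t in nhds r, (x, t) ∈ C :=
      hcont.continuousAt.eventually (mem_interior_iff_mem_nhds.1 hr)
    obtain ⟨t, htC, ht⟩ := ((hnhds.filter_mono nhdsWithin_le_nhds).and
      (self_mem_nhdsWithin : Set.Iio r ∈ nhdsWithin r (Set.Iio r))).exists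
    have := h x t s htC hs
    have ht : t < r := ht
    linarith
  -- `T` flips `D` into a set lying strictly below `interior C` on each vertical line, so the two
  -- can be separated.
  let T : E × ℝ → E × ℝ := fun p => (p.1, a p.1 - α - p.2)
  have hT : Convex ℝ (T '' D) := by
    rintro _ ⟨p, hp, rfl⟩ _ ⟨q, hq, rfl⟩ u v hu hv huv
    refine ⟨u • p + v • q, hD hp hq hu hv huv, ?_⟩
    ext
    · rfl
    · simp only [T, Prod.fst_add, Prod.snd_add, Prod.smul_fst, Prod.smul_snd, map_add, map_smul,
        smul_eq_mul]
      linear_combination α * huv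
  obtain ⟨φ, u, hφC, hφD⟩ := geometric_hahn_banach_open hC.interior isOpen_interior hT (by
    rw [Set.disjoint_left]
    rintro _ hp ⟨⟨x, s⟩, hs, rfl⟩
    have := hlt _ _ _ hp hs
    simp only at this
    linarith)
  have hφ : ∀ x r, φ (x, r) = φ (x, 0) + r * φ (0, 1) := fun x r => by
    rw [← smul_eq_mul, ← map_smul, ← map_add]; simp
  obtain ⟨r₀, hr₀⟩ := hx₀C
  obtain ⟨s₀, hs₀⟩ := hx₀D
  have hφC' : ∀ p ∈ C, φ p ≤ u := by
    intro p hp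
    have hcl : p ∈ closure (interior C) := by
      rw [hC.closure_interior_eq_closure_of_nonempty_interior ⟨_, hr₀⟩]
      exact subset_closure hp
    exact closure_minimal (fun q hq => (hφC q hq).le)
      (isClosed_le φ.continuous continuous_const) hcl
  -- Both separated sets meet the vertical line over `x₀`, so `φ` cannot vanish on it.
  have hneg : φ (0, 1) < 0 := by
    have h1 := hφC _ hr₀
    have h2 := hφD _ ⟨_, hs₀, rfl⟩
    have h3 := hlt _ _ _ hr₀ hs₀
    simp only [T] at h2
    rw [hφ] at h1 h2
    by_contra! hc
    nlinarith
  set c := -φ (0, 1) with hc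
  have hcpos : 0 < c := by linarith
  refine ⟨c⁻¹ • φ.comp (ContinuousLinearMap.inl ℝ E ℝ), c⁻¹ * u, ?_, ?_⟩
  · rintro ⟨x, r⟩ hp
    have h1 := hφC' _ hp
    rw [hφ] at h1
    simp only [smul_apply, ContinuousLinearMap.comp_apply,
      ContinuousLinearMap.inl_apply, smul_eq_mul]
    have h2 : c⁻¹ * (φ (x, 0) - r * c) ≤ c⁻¹ * u :=
      mul_le_mul_of_nonneg_left (by rw [hc]; linarith) (by positivity)
    have h3 : c⁻¹ * (φ (x, 0) - r * c) = c⁻¹ * φ (x, 0) - r := by field_simp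
    linarith
  · rintro ⟨x, s⟩ hp
    have h1 := hφD _ ⟨_, hp, rfl⟩
    simp only [T] at h1
    rw [hφ] at h1
    simp only [sub_apply, smul_apply,
      ContinuousLinearMap.comp_apply, ContinuousLinearMap.inl_apply, smul_eq_mul]
    have h2 : c⁻¹ * u ≤ c⁻¹ * (φ (x, 0) - (a x - α - s) * c) :=
      mul_le_mul_of_nonneg_left (by rw [hc]; linarith) (by positivity)
    have h3 : c⁻¹ * (φ (x, 0) - (a x - α - s) * c) = c⁻¹ * φ (x, 0) - (a x - α - s) := by
      field_simp
    linarith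

theorem IsPolyhedral.convex {S : Set E} (h : IsPolyhedral S) : Convex ℝ S := by
  obtain ⟨n, a, b, -, rfl⟩ := h
  exact convex_iInter fun i => convex_halfSpace_le (a i).toLinearMap.isLinear (b i)

/-- An affine minorant of a sum splits into affine minorants of the summands, each summand being
polyhedral or bounded above near a common point `x₀` of the domains. -/
theorem exists_split {ι : Type*} [DecidableEq ι] (C : ι → Set (E × ℝ)) (p t : Finset ι)
    (hp : ∀ i ∈ p, IsPolyhedral (C i)) (hC : ∀ i ∈ t, Convex ℝ (C i)) {x₀ : E}
    (hne : ∀ i, ∃ r, (x₀, r) ∈ C i) (hint : ∀ i ∈ t, ∃ r, (x₀, r) ∈ interior (C i))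
    (hdisj : Disjoint p t) (a : E →L[ℝ] ℝ) (α : ℝ)
    (h : ∀ (x : E) (r : ι → ℝ), (∀ i ∈ p ∪ t, (x, r i) ∈ C i) →
      a x - ∑ i ∈ p ∪ t, r i ≤ α) :
    ∃ (w : ι → E →L[ℝ] ℝ) (β : ι → ℝ), (∀ i ∈ p ∪ t, ∀ q ∈ C i, w i q.1 - q.2 ≤ β i) ∧
      ∑ i ∈ p ∪ t, w i = a ∧ ∑ i ∈ p ∪ t, β i ≤ α := by
  choose r₀ hr₀ using hne
  induction t using Finset.induction_on generalizing a α with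
  | empty =>
    rw [Finset.union_empty] at *
    obtain ⟨w, β, hw, hs, hβ⟩ := exists_split_polyhedral (fun i : p => C i)
      (fun i => hp i i.2) ⟨x₀, fun i => r₀ i, fun i => hr₀ i⟩ a α (by
        intro x r hx
        have := h x (fun i => if hi : i ∈ p then r ⟨i, hi⟩ else 0) (by
          intro i hi
          simpa [hi] using hx ⟨i, hi⟩)
        rw [← Finset.sum_coe_sort] at this
        simpa using this)
    refine ⟨fun i => if hi : i ∈ p then w ⟨i, hi⟩ else 0,
      fun i => if hi : i ∈ p then β ⟨i, hi⟩ else 0, ?_, ?_, ?_⟩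
    · intro i hi
      simpa [hi] using hw ⟨i, hi⟩
    · rw [← Finset.sum_coe_sort]
      simpa using hs
    · rw [← Finset.sum_coe_sort]
      simpa using hβ
  | insert j t hj ih =>
    rw [Finset.disjoint_insert_right] at hdisj
    have hjs : j ∉ p ∪ t := by simp [hdisj.1, hj]
    rw [Finset.union_insert] at *
    -- `D` plays the role of the epigraph of the sum of the remaining functions.
    let D : Set (E × ℝ) :=
      {q | ∃ r : ι → ℝ, (∀ i ∈ p ∪ t, (q.1, r i) ∈ C i) ∧ q.2 = ∑ i ∈ p ∪ t, r i}
    have hD : Convex ℝ D := by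
      rintro ⟨x, s⟩ ⟨r, hr, hs⟩ ⟨x', s'⟩ ⟨r', hr', hs'⟩ u v hu hv huv
      refine ⟨u • r + v • r', fun i hi => ?_, ?_⟩
      · have hCi : Convex ℝ (C i) := by
          rcases Finset.mem_union.1 hi with hi | hi
          · exact (hp i hi).convex
          · exact hC i (Finset.mem_insert_of_mem hi)
        exact hCi (hr i hi) (hr' i hi) hu hv huv
      · simp only at hs hs'
        simp [hs, hs', Finset.sum_add_distrib, Finset.mul_sum]
    obtain ⟨v, γ, hv, hvD⟩ := exists_split_of_interior (hC j (Finset.mem_insert_self _ _)) hD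
      (hint j (Finset.mem_insert_self _ _)) ⟨_, r₀, fun i _ => hr₀ i, rfl⟩ a α (by
        rintro x r s hr ⟨r', hr', hs⟩
        have key : ∀ i ∈ p ∪ t, Function.update r' j r i = r' i := fun i hi =>
          Function.update_of_ne (by rintro rfl; exact hjs hi) _ _
        have := h x (Function.update r' j r) (by
          intro i hi
          rcases Finset.mem_insert.1 hi with rfl | hi
          · simpa using hr
          · rw [key i hi]
            exact hr' i hi)
        rwa [Finset.sum_insert hjs, Function.update_self, Finset.sum_congr rfl key,
          ← hs] at this)
    obtain ⟨w, β, hw, hs, hβ⟩ := ih (fun i hi => hC i (Finset.mem_insert_of_mem hi))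
      (fun i hi => hint i (Finset.mem_insert_of_mem hi)) hdisj.2 (a - v) (α - γ)
      (fun x r hr => hvD (x, _) ⟨r, hr, rfl⟩)
    have hne : ∀ i ∈ p ∪ t, i ≠ j := by
      rintro i hi rfl
      exact hjs hi
    refine ⟨Function.update w j v, Function.update β j γ, ?_, ?_, ?_⟩
    · intro i hi
      rcases Finset.mem_insert.1 hi with rfl | hi
      · simpa using hv
      · rw [Function.update_of_ne (hne i hi), Function.update_of_ne (hne i hi)]
        exact hw i hi
    · rw [Finset.sum_insert hjs, Finset.sum_update_of_notMem hjs, hs]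
      simp
    · rw [Finset.sum_insert hjs, Finset.sum_update_of_notMem hjs]
      simp only [Function.update_self]
      linarith

end Epigraphs

/-! ### Conjugates and subgradients in terms of epigraphs -/

section Conjugates

variable {E : Type*} [NormedAddCommGroup E] [NormedSpace ℝ E]

theorem ereal_sum_ne_bot {ι : Type*} (s : Finset ι) (g : ι → EReal) (h : ∀ i ∈ s, g i ≠ ⊥) :
    ∑ i ∈ s, g i ≠ ⊥ := by
  classical
  induction s using Finset.induction_on with
  | empty => simp
  | insert j s hj ih =>
    rw [Finset.sum_insert hj, Ne, EReal.add_eq_bot_iff, not_or]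
    exact ⟨h j (Finset.mem_insert_self _ _), ih fun i hi => h i (Finset.mem_insert_of_mem hi)⟩

theorem ereal_sum_eq_top {ι : Type*} (s : Finset ι) (g : ι → EReal) (h : ∀ i ∈ s, g i ≠ ⊥)
    {j : ι} (hj : j ∈ s) (hjt : g j = ⊤) : ∑ i ∈ s, g i = ⊤ := by
  classical
  rw [← Finset.add_sum_erase s g hj, hjt]
  exact EReal.top_add_of_ne_bot
    (ereal_sum_ne_bot _ _ fun i hi => h i (Finset.mem_of_mem_erase hi))

theorem ereal_coe_sum {ι : Type*} (s : Finset ι) (g : ι → ℝ) :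
    ((∑ i ∈ s, g i : ℝ) : EReal) = ∑ i ∈ s, (g i : EReal) := by
  classical
  induction s using Finset.induction_on with
  | empty => simp
  | insert j s hj ih => rw [Finset.sum_insert hj, Finset.sum_insert hj, EReal.coe_add, ih]

theorem conjugate_le_coe_iff {f : E → EReal} (hf : ∀ x, f x ≠ ⊥) (w : E →L[ℝ] ℝ) (β : ℝ) :
    conjugate f w ≤ β ↔ ∀ p ∈ epi f, w p.1 - p.2 ≤ β := by
  rw [conjugate, iSup_le_iff]
  constructor
  · rintro h ⟨x, r⟩ hp
    have : ((w x - r : ℝ) : EReal) ≤ β := by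
      rw [EReal.coe_sub]
      exact (EReal.sub_le_sub le_rfl hp).trans (h x)
    exact_mod_cast this
  · intro h x
    by_cases ht : f x = ⊤
    · simp [ht]
    · have hx : ((f x).toReal : EReal) = f x := EReal.coe_toReal ht (hf x)
      have := h (x, (f x).toReal) hx.ge
      rw [← hx, ← EReal.coe_sub]
      exact_mod_cast this

/-- Same inequality as in `conjugate_le_coe_iff` with `β = w x - r`, so one splitting result serves
both claims. -/
theorem mem_subdifferential_iff {f : E → EReal} (hf : ∀ x, f x ≠ ⊥) {x : E} {r : ℝ}
    (hx : f x = r) (w : E →L[ℝ] ℝ) :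
    w ∈ subdifferential f x ↔ ∀ p ∈ epi f, w p.1 - p.2 ≤ w x - r := by
  simp only [subdifferential, Set.mem_ofPred_eq, hx, EReal.coe_ne_bot, EReal.coe_ne_top, ne_eq,
    not_false_iff, true_and, ← EReal.coe_add]
  constructor
  · rintro h ⟨y, s⟩ hp
    have : ((w (y - x) + r : ℝ) : EReal) ≤ s := (h y).trans hp
    have : w (y - x) + r ≤ s := by exact_mod_cast this
    rw [map_sub] at this
    simp only
    linarith
  · intro h y
    by_cases ht : f y = ⊤
    · simp [ht]
    · have hy : ((f y).toReal : EReal) = f y := EReal.coe_toReal ht (hf y)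
      have := h (y, (f y).toReal) hy.ge
      rw [← hy, EReal.coe_le_coe_iff, map_sub]
      simp only at this
      linarith

theorem conjugate_sum_le {ι : Type*} [Fintype ι] (f : ι → E → EReal) (hf : ∀ i x, f i x ≠ ⊥)
    (w : ι → E →L[ℝ] ℝ) :
    conjugate (fun x => ∑ i, f i x) (∑ i, w i) ≤ ∑ i, conjugate (f i) (w i) := by
  refine iSup_le fun x => ?_
  by_cases ht : ∃ i, f i x = ⊤
  · obtain ⟨i, hi⟩ := ht
    simp [ereal_sum_eq_top _ _ (fun i _ => hf i x) (Finset.mem_univ i) hi]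
  · push Not at ht
    choose r hr using fun i => (⟨_, (EReal.coe_toReal (ht i) (hf i x)).symm⟩ :
      ∃ r : ℝ, f i x = r)
    calc (((∑ i, w i) x : ℝ) : EReal) - ∑ i, f i x
        = ∑ i, ((w i x - r i : ℝ) : EReal) := by
          simp only [hr]
          rw [← ereal_coe_sum, ← EReal.coe_sub, ← ereal_coe_sum, sum_apply,
            Finset.sum_sub_distrib]
      _ ≤ ∑ i, conjugate (f i) (w i) := Finset.sum_le_sum fun i _ => by
          rw [EReal.coe_sub, ← hr i]
          exact le_iSup (fun x => ((w i x : ℝ) : EReal) - f i x) x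

/-- A real `r > f x₀` still exceeds `f` near `x₀`, so height `r + 1` leaves room on all sides. -/
theorem exists_mem_interior_epi {X : Type*} [TopologicalSpace X] {f : X → EReal} {x₀ : X} (hx₀ : x₀ ∈ dom f)
    (hc : ContinuousAt f x₀) : ∃ r : ℝ, (x₀, r) ∈ interior (epi f) := by
  obtain ⟨r, hr, -⟩ := EReal.lt_iff_exists_real_btwn.1 hx₀
  refine ⟨r + 1, mem_interior_iff_mem_nhds.2 ?_⟩
  filter_upwards [prod_mem_nhds (hc.eventually (gt_mem_nhds hr)) (Ioi_mem_nhds (lt_add_one r))]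
    with p hp
  exact hp.1.le.trans (EReal.coe_le_coe_iff.2 (le_of_lt hp.2))

end Conjugates

end ConvexDuality

open ConvexDuality

theorem mainTheorem10 (d m k : ℕ) (hm : 1 ≤ m) (hk : k ≤ m)
    (f : Fin m → EuclideanSpace ℝ (Fin d) → EReal)
    (hbot : ∀ i x, f i x ≠ ⊥)
    (hpoly : ∀ i : Fin m, (i : ℕ) < k → ConvexDuality.IsPolyhedrallyConvex (f i))
    (hconv : ∀ i : Fin m, k ≤ (i : ℕ) →
      ConvexDuality.IsProper (f i) ∧ ConvexDuality.IsConvex (f i))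
    (hcq : ∃ x₀ : EuclideanSpace ℝ (Fin d), (∀ i, x₀ ∈ ConvexDuality.dom (f i)) ∧
      ∀ i : Fin m, k ≤ (i : ℕ) → ContinuousAt (f i) x₀) :
    (∀ xs : EuclideanSpace ℝ (Fin d) →L[ℝ] ℝ,
      ConvexDuality.conjugate (fun x => ∑ i, f i x) xs =
          ConvexDuality.infConv (fun i => ConvexDuality.conjugate (f i)) xs ∧
        ConvexDuality.InfConvExactAt (fun i => ConvexDuality.conjugate (f i)) xs) ∧
    ∀ x : EuclideanSpace ℝ (Fin d),
      ConvexDuality.subdifferential (fun y => ∑ i, f i y) x =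
        ∑ i, ConvexDuality.subdifferential (f i) x := by
  obtain ⟨x₀, hdom, hcont⟩ := hcq
  have hsum : ∀ x, ∑ i, f i x ≠ ⊥ := fun x => ereal_sum_ne_bot _ _ fun i _ => hbot i x
  have hepi : ∀ (x : EuclideanSpace ℝ (Fin d)) (r : Fin m → ℝ), (∀ i, (x, r i) ∈ epi (f i)) →
      (x, ∑ i, r i) ∈ epi fun x => ∑ i, f i x := fun x r hr => by
    simp only [epi, Set.mem_ofPred_eq, ereal_coe_sum]
    exact Finset.sum_le_sum fun i _ => hr i
  have hx₀ : ∀ i, (x₀, (f i x₀).toReal) ∈ epi (f i) := fun i =>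
    (EReal.coe_toReal (hdom i).ne (hbot i x₀)).ge
  have hsplit : ∀ (a : EuclideanSpace ℝ (Fin d) →L[ℝ] ℝ) (α : ℝ),
      (∀ p ∈ epi fun x => ∑ i, f i x, a p.1 - p.2 ≤ α) →
      ∃ (w : Fin m → EuclideanSpace ℝ (Fin d) →L[ℝ] ℝ) (β : Fin m → ℝ),
        (∀ i, ∀ q ∈ epi (f i), w i q.1 - q.2 ≤ β i) ∧ ∑ i, w i = a ∧ ∑ i, β i ≤ α := by
    intro a α h
    have hu : (Finset.univ.filter fun i : Fin m => (i : ℕ) < k) ∪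
        (Finset.univ.filter fun i : Fin m => ¬ (i : ℕ) < k) = Finset.univ :=
      Finset.filter_union_filter_not_eq _ _
    have := exists_split (fun i => epi (f i)) (Finset.univ.filter fun i : Fin m => (i : ℕ) < k)
      (Finset.univ.filter fun i : Fin m => ¬ (i : ℕ) < k) (x₀ := x₀)
      (fun i hi => hpoly i (Finset.mem_filter.1 hi).2)
      (fun i hi => (hconv i (not_lt.1 (Finset.mem_filter.1 hi).2)).2)
      (fun i => ⟨_, hx₀ i⟩)
      (fun i hi => exists_mem_interior_epi (hdom i)
        (hcont i (not_lt.1 (Finset.mem_filter.1 hi).2)))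
      (Finset.disjoint_filter_filter_not _ _ _) a α
      (by
        rw [hu]
        exact fun x r hr => h _ (hepi x r fun i => hr i (Finset.mem_univ i)))
    rw [hu] at this
    simpa using this
  refine ⟨fun xs => ?_, fun x => ?_⟩
  · have hle : conjugate (fun x => ∑ i, f i x) xs ≤ infConv (fun i => conjugate (f i)) xs :=
      le_iInf₂ fun w hw => hw ▸ conjugate_sum_le f hbot w
    have hge : ∀ w : Fin m → EuclideanSpace ℝ (Fin d) →L[ℝ] ℝ, ∑ i, w i = xs →
        infConv (fun i => conjugate (f i)) xs ≤ ∑ i, conjugate (f i) (w i) :=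
      fun w hw => iInf₂_le w hw
    suffices ∃ w : Fin m → EuclideanSpace ℝ (Fin d) →L[ℝ] ℝ, ∑ i, w i = xs ∧
        ∑ i, conjugate (f i) (w i) ≤ conjugate (fun x => ∑ i, f i x) xs by
      obtain ⟨w, hw, h⟩ := this
      exact ⟨hle.antisymm ((hge w hw).trans h), w, hw, (h.trans hle).antisymm (hge w hw)⟩
    by_cases ht : conjugate (fun x => ∑ i, f i x) xs = ⊤
    -- Any decomposition attains the value `⊤`; `hm` supplies an index to carry `xs`.
    · exact ⟨Pi.single ⟨0, hm⟩ xs, by simp, by simp [ht]⟩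
    have hb : conjugate (fun x => ∑ i, f i x) xs ≠ ⊥ := by
      intro hb
      -- The value at `x₀` is a finite lower bound for the conjugate; a bound smaller by 1 is
      -- absurd.
      have h := (conjugate_le_coe_iff hsum xs
        (xs x₀ - ∑ i, (f i x₀).toReal - 1)).1 (hb ▸ bot_le) _ (hepi x₀ _ hx₀)
      simp only at h
      linarith
    have hα := EReal.coe_toReal ht hb
    obtain ⟨w, β, hw, hs, hβ⟩ := hsplit xs _ ((conjugate_le_coe_iff hsum xs _).1 hα.ge)
    refine ⟨w, hs, ?_⟩
    calc ∑ i, conjugate (f i) (w i) ≤ ∑ i, (β i : EReal) :=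
          Finset.sum_le_sum fun i _ => (conjugate_le_coe_iff (hbot i) _ _).2 (hw i)
      _ ≤ _ := by
          rw [← ereal_coe_sum, ← hα]
          exact EReal.coe_le_coe_iff.2 hβ
  · ext xs
    rw [Set.mem_fintype_sum]
    by_cases ht : ∃ i, f i x = ⊤
    · obtain ⟨i, hi⟩ := ht
      constructor
      · intro h
        exact absurd (ereal_sum_eq_top _ _ (fun i _ => hbot i x) (Finset.mem_univ i) hi) h.2.1
      · rintro ⟨g, hg, -⟩
        exact absurd hi (hg i).2.1
    push Not at ht
    choose r hr using fun i => (⟨_, (EReal.coe_toReal (ht i) (hbot i x)).symm⟩ :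
      ∃ r : ℝ, f i x = r)
    have hrs : ∑ i, f i x = ((∑ i, r i : ℝ) : EReal) := by simp only [hr, ereal_coe_sum]
    rw [mem_subdifferential_iff hsum hrs]
    constructor
    · intro h
      obtain ⟨w, β, hw, hs, hβ⟩ := hsplit xs _ h
      have hle : ∀ i, w i x - r i ≤ β i := fun i => hw i (x, r i) (hr i).le
      -- The termwise bounds `hle` add up to the reverse of `hβ`, so each of them is tight.
      have heq : ∀ i, w i x - r i = β i := fun i => by
        refine (Finset.sum_eq_sum_iff_of_le fun i _ => hle i).1 ?_ i (Finset.mem_univ i)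
        refine (Finset.sum_le_sum fun i _ => hle i).antisymm (hβ.trans_eq ?_)
        rw [Finset.sum_sub_distrib, ← hs, sum_apply]
      refine ⟨w, fun i => (mem_subdifferential_iff (hbot i) (hr i) _).2 fun q hq => ?_, hs⟩
      rw [heq i]
      exact hw i q hq
    · rintro ⟨w, hw, rfl⟩
      rw [← mem_subdifferential_iff hsum hrs]
      refine ⟨hsum x, by simp [hrs], fun y => ?_⟩
      calc (((∑ i, w i) (y - x) : ℝ) : EReal) + ∑ i, f i x
          = ∑ i, (((w i (y - x) : ℝ) : EReal) + f i x) := by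
            rw [Finset.sum_add_distrib, sum_apply, ereal_coe_sum]
        _ ≤ ∑ i, f i y := Finset.sum_le_sum fun i _ => (hw i).2.2 y
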